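/- Theorem 4.2 (Dual graph). Let $K$ be a field and let $G$ be a finite simple graph with vertex set $V$. Let $R=K[x_i,y_i : i\in V]$ and let $J_G=(x_iy_j-x_jy_i : \{i,j\}\text{ is an edge of }G)\subseteq R$ be the binomial edge ideal of $G$. For $S\subseteq V$ let $c_G(S)$ be the number of connected components of $G-S$, the subgraph of $G$ induced on $V\setminus S$. Call $S$ a cut set of $G$ if $c_G(S\setminus\{i\})<c_G(S)$ for every $i\in S$ (in particular, $\emptyset$ is a cut set), and call a vertex $v$ a cut vertex if $\{v\}$ is a cut set. Let $G_1,\dots,G_{c_G(S)}$ be the connected components of $G-S$, let $\widetilde G_k$ be the complete graph on the vertex set of $G_k$, and put $$P_S=\Big(\bigcup_{i\in S}\{x_i,y_i\},\ J_{\widetilde G_1},\dots,J_{\widetilde G_{c_G(S)}}\Big)\subseteq R.$$ The dual graph $\mathcal D(I)$ of an ideal $I$ has the minimal primes of $I$ as vertices, two distinct minimal primes $\mathfrak p,\mathfrak q$ being adjacent if and only if $\operatorname{ht}(\mathfrak p+\mathfrak q)-1=\operatorname{ht}(\mathfrak p)=\operatorname{ht}(\mathfrak q)=\operatorname{ht}(I)$.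 Assume that $J_G$ is unmixed, that is, all minimal primes of $J_G$ have the same height, and let $S,T$ be cut sets of $G$ with $|T|\ge|S|$. Then $P_S$ and $P_T$ are minimal primes of $J_G$, and the following hold. a) If $|T\setminus S|>1$, then $P_S$ and $P_T$ are not adjacent in $\mathcal D(J_G)$. b) If $|T\setminus S|=1$ and $S\subseteq T$, then $P_S$ and $P_T$ are adjacent in $\mathcal D(J_G)$. c) If $T\setminus S=\{t\}$ and $S\not\subseteq T$, then $P_S$ and $P_T$ are adjacent in $\mathcal D(J_G)$ if and only if $t$ is not a cut vertex of $G-S$. -/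

import Mathlib

noncomputable section

namespace BinomialEdge

/-- An ideal is unmixed if all its minimal primes have the same height. -/
def IsUnmixed {A : Type*} [CommRing A] (I : Ideal A) : Prop :=
  ∀ p ∈ I.minimalPrimes, ∀ q ∈ I.minimalPrimes, p.height = q.height

/-- The dual graph of an ideal `I`: its vertices are the minimal primes of `I`, and two distinct
minimal primes `p`, `q` are joined if and only if `ht (p + q) - 1 = ht p = ht q = ht I`.
(Heights live in `ℕ∞`, so the first equality is written without subtraction.) -/
def dualGraph {A : Type*} [CommRing A] (I : Ideal A) : SimpleGraph I.minimalPrimes where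
  Adj p q := p ≠ q ∧ (p.1 ⊔ q.1).height = p.1.height + 1 ∧
    p.1.height = I.height ∧ q.1.height = I.height
  symm := by
    constructor
    rintro p q ⟨hne, h, hp, hq⟩
    refine ⟨hne.symm, ?_, hq, hp⟩
    rw [sup_comm, h, hp, hq]
  loopless := ⟨fun _ h => h.1 rfl⟩

variable {V : Type*} (K : Type*) [Field K]

/-- The polynomial ring `K[x_i, y_i : i ∈ V]`. -/
abbrev PolyRing (V : Type*) (K : Type*) [Field K] : Type _ := MvPolynomial (V ⊕ V) K

/-- The variable `x_i`. -/
def x (i : V) : PolyRing V K := MvPolynomial.X (Sum.inl i)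

/-- The variable `y_i`. -/
def y (i : V) : PolyRing V K := MvPolynomial.X (Sum.inr i)

/-- The binomial edge ideal `J_G`, generated by `x_i y_j - x_j y_i` for the edges `{i, j}`. -/
def binomialEdgeIdeal (G : SimpleGraph V) : Ideal (PolyRing V K) :=
  Ideal.span {f | ∃ i j, G.Adj i j ∧ f = x K i * y K j - x K j * y K i}

/-- The complete graph on a subset `W` of `V`, viewed as a graph on `V` (all other vertices are
isolated). -/
def completeOn (W : Set V) : SimpleGraph V where
  Adj i j := i ≠ j ∧ i ∈ W ∧ j ∈ W
  symm := ⟨fun _ _ h => ⟨h.1.symm, h.2.2, h.2.1⟩⟩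
  loopless := ⟨fun _ h => h.1 rfl⟩

/-- The ideal `P_S(G)`, generated by the variables `x_i, y_i` for `i ∈ S` and by the binomial edge
ideals of the complete graphs on the vertex sets of the connected components of `G` minus `S`. -/
def primeIdeal (G : SimpleGraph V) (S : Set V) : Ideal (PolyRing V K) :=
  Ideal.span {f | ∃ i ∈ S, f = x K i ∨ f = y K i} ⊔
    ⨆ C : (G.induce Sᶜ).ConnectedComponent,
      binomialEdgeIdeal K (completeOn ((Subtype.val : ↥(Sᶜ) → V) '' C.supp))

/-- `c_G(S)`, the number of connected components of the subgraph of `G` induced on the complement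
of `S` (used for finite graphs only). -/
def numComponents (G : SimpleGraph V) (S : Set V) : ℕ :=
  Nat.card (G.induce Sᶜ).ConnectedComponent

/-- `S` is a cut set of `G` if `c_G(S \ {i}) < c_G(S)` for every `i ∈ S`; in particular the
empty set is a cut set. -/
def IsCutSet (G : SimpleGraph V) (S : Set V) : Prop :=
  ∀ i ∈ S, numComponents G (S \ {i}) < numComponents G S

/-- `v` is a cut vertex of `G` if `{v}` is a cut set of `G`. -/
def IsCutVertex (G : SimpleGraph V) (v : V) : Prop := IsCutSet G {v}

end BinomialEdge

end

noncomputable section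

namespace BinomialEdge

variable {V : Type*} (K : Type*) [Field K]

/-! Each `P_S` is a label ideal: the variables of `S` together with the minors of pairs of vertices
carrying the same label, the labels being the components of `G - S`. Label ideals are prime
(`labelIdeal_eq_ker`), their inclusions are read off from sets and labels
(`labelIdeal_le_labelIdeal_iff`), and height plus number of labels off `S` is `|V| + |S|`
(`height_labelIdeal_add`). This turns the theorem into combinatorics of partitions.

By unmixedness, adjacency means that `P_S + P_T` has height `ht P_S + 1`. Then some prime `Q` of
that height contains the sum, and any prime inside `Q` strictly above `P_S` or `P_T` is `Q`. For `t
∈ T \ S` this forces `Q = P_S + (x_t, y_t)`, so `T \ S` has no second element. If also `s ∈ S \ T`,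
then `Q = P_T + (x_s, y_s)` too, so `G - S` and `G - T` induce the same partition off `S ∪ T`. When
`t` is a cut vertex of `G - S`, this is impossible (`not_forall_compLabel_iff_of_isCutVertex`).

Conversely, `P_S + (x_t, y_t)` has height `ht P_S + 1` as soon as `t` has a neighbour off `S ∪ {t}`,
so it suffices that it contains `P_T` (`height_sup_eq`). For `S ⊆ T` this is clear. In the exchange
case, if `t` is not a cut vertex, the partition by `G - S` refines the one by `G - T` off `S ∪ T`;
unmixedness gives both equally many classes, so they agree. -/

/-- The ideal generated by the variables `x_i, y_i` with `i ∈ S` and by the minors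
`x_i y_j - x_j y_i` for all `i, j` carrying the same label. -/
def labelIdeal {L : Type*} (S : Set V) (f : V → L) : Ideal (PolyRing V K) :=
  Ideal.span {p | (∃ i ∈ S, p = x K i ∨ p = y K i) ∨
    ∃ i j, f i = f j ∧ p = x K i * y K j - x K j * y K i}

variable {K}

/-! ### Membership and inclusions for label ideals -/

section Membership

variable {L : Type*} {S : Set V} {f : V → L}

lemma x_mem_labelIdeal {i : V} (hi : i ∈ S) : x K i ∈ labelIdeal K S f :=
  Ideal.subset_span (Or.inl ⟨i, hi, Or.inl rfl⟩)

lemma y_mem_labelIdeal {i : V} (hi : i ∈ S) : y K i ∈ labelIdeal K S f :=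
  Ideal.subset_span (Or.inl ⟨i, hi, Or.inr rfl⟩)

lemma minor_mem_labelIdeal {i j : V} (h : f i = f j) :
    x K i * y K j - x K j * y K i ∈ labelIdeal K S f :=
  Ideal.subset_span (Or.inr ⟨i, j, h, rfl⟩)

lemma minor_mem_of_left {Q : Ideal (PolyRing V K)} {i : V} (j : V) (hx : x K i ∈ Q)
    (hy : y K i ∈ Q) : x K i * y K j - x K j * y K i ∈ Q :=
  Q.sub_mem (Q.mul_mem_right _ hx) (Q.mul_mem_left _ hy)

lemma minor_mem_of_right {Q : Ideal (PolyRing V K)} (i : V) {j : V} (hx : x K j ∈ Q)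
    (hy : y K j ∈ Q) : x K i * y K j - x K j * y K i ∈ Q :=
  Q.sub_mem (Q.mul_mem_left _ hy) (Q.mul_mem_right _ hx)

lemma labelIdeal_le {Q : Ideal (PolyRing V K)} (hS : ∀ i ∈ S, x K i ∈ Q ∧ y K i ∈ Q)
    (hf : ∀ i j, i ∉ S → j ∉ S → f i = f j → x K i * y K j - x K j * y K i ∈ Q) :
    labelIdeal K S f ≤ Q := by
  refine Ideal.span_le.2 ?_
  rintro p (⟨i, hi, rfl | rfl⟩ | ⟨i, j, hij, rfl⟩)
  · exact (hS i hi).1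
  · exact (hS i hi).2
  · by_cases hi : i ∈ S
    · exact minor_mem_of_left j (hS i hi).1 (hS i hi).2
    by_cases hj : j ∈ S
    · exact minor_mem_of_right i (hS j hj).1 (hS j hj).2
    exact hf i j hi hj hij

/-- A common zero of the generators is a zero of every element of the ideal. -/
lemma aeval_eq_zero_of_mem_labelIdeal {a b : V → K} (hS : ∀ i ∈ S, a i = 0 ∧ b i = 0)
    (hf : ∀ i j, f i = f j → a i * b j - a j * b i = 0) {p : PolyRing V K}
    (hp : p ∈ labelIdeal K S f) : MvPolynomial.aeval (Sum.elim a b) p = 0 := by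
  have : labelIdeal K S f ≤ RingHom.ker (MvPolynomial.aeval (R := K) (Sum.elim a b)) := by
    refine Ideal.span_le.2 ?_
    rintro p (⟨i, hi, rfl | rfl⟩ | ⟨i, j, hij, rfl⟩)
    · simpa [x] using (hS i hi).1
    · simpa [y] using (hS i hi).2
    · simpa [x, y] using hf i j hij
  exact this hp

lemma x_mem_labelIdeal_iff {i : V} : x K i ∈ labelIdeal K S f ↔ i ∈ S := by
  classical
  refine ⟨fun h => ?_, x_mem_labelIdeal⟩
  by_contra hi
  -- A zero of the ideal at which `x_i` does not vanish.
  have := aeval_eq_zero_of_mem_labelIdeal (a := fun k => if k ∈ S then 0 else 1) (b := fun _ => 0)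
    (fun i hi => by simp [hi]) (fun i j _ => by simp) h
  simp [x, hi] at this

lemma minor_mem_labelIdeal_iff {i j : V} (hi : i ∉ S) (hj : j ∉ S) :
    x K i * y K j - x K j * y K i ∈ labelIdeal K S f ↔ f i = f j := by
  classical
  refine ⟨fun h => ?_, minor_mem_labelIdeal⟩
  by_contra hij
  -- The indicators of the classes of `i` and `j` form a zero of the ideal at which the minor is
  -- `1`.
  have := aeval_eq_zero_of_mem_labelIdeal (a := fun k => if k ∉ S ∧ f k = f i then 1 else 0)
    (b := fun k => if k ∉ S ∧ f k = f j then 1 else 0)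
    (fun i hi => by simp [hi]) (fun k l hkl => by
      by_cases hk : k ∈ S <;> by_cases hl : l ∈ S <;> simp [hk, hl, hkl]) h
  simp [x, y, hi, hj, hij] at this

/-- Inclusions of label ideals are detected on the sets and the labels. -/
theorem labelIdeal_le_labelIdeal_iff {L' : Type*} {S' : Set V} {f' : V → L'} :
    labelIdeal K S f ≤ labelIdeal K S' f' ↔
      S ⊆ S' ∧ ∀ i j, i ∉ S' → j ∉ S' → f i = f j → f' i = f' j := by
  constructor
  · intro h
    exact ⟨fun i hi => x_mem_labelIdeal_iff.1 (h (x_mem_labelIdeal hi)),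
      fun i j hi hj hij => (minor_mem_labelIdeal_iff hi hj).1 (h (minor_mem_labelIdeal hij))⟩
  · rintro ⟨hS, hf⟩
    refine labelIdeal_le (fun i hi => ⟨x_mem_labelIdeal (hS hi), y_mem_labelIdeal (hS hi)⟩) ?_
    intro i j _ _ hij
    by_cases hi : i ∈ S'
    · exact minor_mem_of_left j (x_mem_labelIdeal hi) (y_mem_labelIdeal hi)
    by_cases hj : j ∈ S'
    · exact minor_mem_of_right i (x_mem_labelIdeal hj) (y_mem_labelIdeal hj)
    exact minor_mem_labelIdeal (hf i j hi hj hij)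

end Membership

/-! ### Primality of label ideals via a toric parametrization -/

section Prime

variable {L : Type*}

/-- The vertex indexing a variable. -/
def baseVertex : V ⊕ V → V := Sum.elim id id

/-- Two monomials in the `x_i, y_i` with the same degree at every vertex, and with the same `x`- and
`y`-degree at every label, are congruent modulo the minors. -/
lemma prod_X_sub_prod_X_mem_labelIdeal (f : V → L) (s t : Multiset (V ⊕ V))
    (hb : s.map baseVertex = t.map baseVertex)
    (hl : s.map (Sum.map f f) = t.map (Sum.map f f)) :
    (s.map MvPolynomial.X).prod - (t.map MvPolynomial.X).prod ∈ labelIdeal K ∅ f := by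
  induction s using Multiset.induction generalizing t with
  | empty =>
    have : t = 0 := by simpa using hb.symm
    simp [this]
  | cons v s ih =>
    have cancel : ∀ t, s.map baseVertex = t.map baseVertex →
        s.map (Sum.map f f) = t.map (Sum.map f f) →
        ((v ::ₘ s).map MvPolynomial.X).prod - ((v ::ₘ t).map MvPolynomial.X).prod
          ∈ labelIdeal K ∅ f := by
      intro t h1 h2
      simpa [mul_sub] using Ideal.mul_mem_left _ (MvPolynomial.X v) (ih t h1 h2)
    by_cases hv : v ∈ t
    · obtain ⟨t, rfl⟩ := Multiset.exists_cons_of_mem hv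
      exact cancel t (by simpa using hb) (by simpa using hl)
    -- The variable `w` sits at the same vertex as `v` with the other letter, and `w'` has the
    -- letter and label of `v`. One minor exchanges the letters of `w` and `w'`, which makes `v`
    -- appear in `t`.
    obtain ⟨w, hw, hwv⟩ := Multiset.mem_map.1 (hb ▸ by simp : baseVertex v ∈ t.map baseVertex)
    obtain ⟨w', hw', hwv'⟩ := Multiset.mem_map.1
      (hl ▸ by simp : Sum.map f f v ∈ t.map (Sum.map f f))
    have hne : w' ≠ w := by
      rintro rfl
      rcases v with i | i <;> rcases w' with j | j <;> simp_all [baseVertex]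
    obtain ⟨t, rfl⟩ := Multiset.exists_cons_of_mem hw
    obtain ⟨t, rfl⟩ := Multiset.exists_cons_of_mem ((Multiset.mem_cons.1 hw').resolve_left hne)
    rcases v with i | i <;> rcases w with k | k <;> rcases w' with j | j <;>
      simp only [baseVertex, Sum.elim_inl, Sum.elim_inr, id, Sum.map_inl, Sum.map_inr,
        Sum.inl.injEq, Sum.inr.injEq, reduceCtorEq] at hwv hwv' <;> subst hwv
    · simp at hv
    · have h1 := cancel (Sum.inr j ::ₘ t) (by
          simp only [Multiset.map_cons, baseVertex, Sum.elim_inl, Sum.elim_inr, id] at hb ⊢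
          exact (Multiset.cons_inj_right _).1 hb)
        (by
          simp only [Multiset.map_cons, Sum.map_inl, Sum.map_inr, hwv'] at hl ⊢
          rw [Multiset.cons_swap] at hl
          exact (Multiset.cons_inj_right _).1 hl)
      have h2 : x K k * y K j - x K j * y K k ∈ labelIdeal K ∅ f :=
        minor_mem_labelIdeal hwv'.symm
      have h3 := Ideal.add_mem _ h1
        (Ideal.mul_mem_right (t.map MvPolynomial.X).prod _ h2)
      convert h3 using 1
      simp only [Multiset.map_cons, Multiset.prod_cons, x, y]
      ring
    · have h1 := cancel (Sum.inl j ::ₘ t) (by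
          simp only [Multiset.map_cons, baseVertex, Sum.elim_inl, Sum.elim_inr, id] at hb ⊢
          exact (Multiset.cons_inj_right _).1 hb)
        (by
          simp only [Multiset.map_cons, Sum.map_inl, Sum.map_inr, hwv'] at hl ⊢
          rw [Multiset.cons_swap] at hl
          exact (Multiset.cons_inj_right _).1 hl)
      have h2 : x K j * y K k - x K k * y K j ∈ labelIdeal K ∅ f :=
        minor_mem_labelIdeal hwv'
      have h3 := Ideal.add_mem _ h1
        (Ideal.mul_mem_right (t.map MvPolynomial.X).prod _ h2)
      convert h3 using 1
      simp only [Multiset.map_cons, Multiset.prod_cons, x, y]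
      ring
    · simp at hv

/-- The monomials of a polynomial ring, indexed by multisets of variables. -/
def multisetBasis (σ : Type*) : Module.Basis (Multiset σ) K (MvPolynomial σ K) := by
  classical exact (MvPolynomial.basisMonomials σ K).reindex Multiset.toFinsupp.toEquiv.symm

lemma multisetBasis_apply {σ : Type*} (s : Multiset σ) :
    multisetBasis (K := K) σ s = (s.map MvPolynomial.X).prod := by
  classical
  induction s using Multiset.induction with
  | empty => simp [multisetBasis, MvPolynomial.basisMonomials]; rfl
  | cons v s ih =>
    rw [Multiset.map_cons, Multiset.prod_cons, ← ih]
    simp [multisetBasis, MvPolynomial.X, MvPolynomial.monomial_mul, ← Multiset.singleton_add]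

/-- The parametrization `x_i ↦ a_i u_{f i}`, `y_i ↦ a_i v_{f i}`. -/
def segreHom (f : V → L) : PolyRing V K →ₐ[K] MvPolynomial (V ⊕ (L ⊕ L)) K :=
  MvPolynomial.aeval fun v =>
    MvPolynomial.X (Sum.inl (baseVertex v)) * MvPolynomial.X (Sum.inr (Sum.map f f v))

lemma segreHom_prod_X (f : V → L) (s : Multiset (V ⊕ V)) :
    segreHom (K := K) f (s.map MvPolynomial.X).prod =
      (((s.map baseVertex).map Sum.inl + (s.map (Sum.map f f)).map Sum.inr).map
        MvPolynomial.X).prod := by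
  rw [map_multiset_prod]
  simp [segreHom, Multiset.map_map, Multiset.prod_map_mul]

lemma mem_labelIdeal_of_segreHom_eq_zero {f : V → L} {p : PolyRing V K} (hp : segreHom f p = 0) :
    p ∈ labelIdeal K ∅ f := by
  classical
  let E : Multiset (V ⊕ V) → Multiset (V ⊕ (L ⊕ L)) := fun s =>
    (s.map baseVertex).map Sum.inl + (s.map (Sum.map f f)).map Sum.inr
  have hE : ∀ s t, E s = E t → s.map baseVertex = t.map baseVertex ∧
      s.map (Sum.map f f) = t.map (Sum.map f f) := by
    have hleft : ∀ s, (E s).filterMap Sum.getLeft? = s.map baseVertex := fun s => by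
      induction s using Multiset.induction with
      | empty => simp [E]
      | cons v s ih =>
        simp only [E, Multiset.map_cons, Multiset.cons_add, Multiset.add_cons] at ih ⊢
        rw [Multiset.filterMap_cons_none _ _ Sum.getLeft?_inr,
          Multiset.filterMap_cons_some _ _ _ Sum.getLeft?_inl, ih]
    have hright : ∀ s, (E s).filterMap Sum.getRight? = s.map (Sum.map f f) := fun s => by
      induction s using Multiset.induction with
      | empty => simp [E]
      | cons v s ih =>
        simp only [E, Multiset.map_cons, Multiset.cons_add, Multiset.add_cons] at ih ⊢
        rw [Multiset.filterMap_cons_some _ _ _ Sum.getRight?_inr,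
          Multiset.filterMap_cons_none _ _ Sum.getRight?_inl, ih]
    intro s t h
    rw [← hleft, ← hleft, ← hright, ← hright, h]
    exact ⟨rfl, rfl⟩
  -- `ψ` sends an image monomial to the class of a chosen preimage, and its values on other
  -- monomials are irrelevant. The quotient map thus factors through `segreHom f`.
  let ψ : MvPolynomial (V ⊕ (L ⊕ L)) K →ₗ[K] PolyRing V K ⧸ labelIdeal K ∅ f :=
    (multisetBasis _).constr K fun e =>
      Ideal.Quotient.mk _ ((Function.invFun E e).map MvPolynomial.X).prod
  have key : ψ ∘ₗ (segreHom f).toLinearMap =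
      (Ideal.Quotient.mkₐ K (labelIdeal K ∅ f)).toLinearMap := by
    refine (multisetBasis (V ⊕ V)).ext fun s => ?_
    have h1 : segreHom f (multisetBasis (K := K) (V ⊕ V) s) = multisetBasis _ (E s) := by
      rw [multisetBasis_apply, segreHom_prod_X, multisetBasis_apply]
    have h2 : E (Function.invFun E (E s)) = E s := Function.invFun_eq ⟨s, rfl⟩
    simp only [LinearMap.comp_apply, AlgHom.toLinearMap_apply, h1, ψ, Module.Basis.constr_basis,
      Ideal.Quotient.mkₐ_eq_mk]
    rw [Ideal.Quotient.eq, multisetBasis_apply]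
    exact prod_X_sub_prod_X_mem_labelIdeal f _ _ (hE _ _ h2).1 (hE _ _ h2).2
  have := LinearMap.congr_fun key p
  simp only [LinearMap.comp_apply, AlgHom.toLinearMap_apply, hp, map_zero,
    Ideal.Quotient.mkₐ_eq_mk] at this
  exact Ideal.Quotient.eq_zero_iff_mem.1 this.symm

open Classical in
/-- The endomorphism setting the variables `x_i, y_i` with `i ∈ S` to zero. -/
def killHom (S : Set V) : PolyRing V K →ₐ[K] PolyRing V K :=
  MvPolynomial.aeval fun v => if baseVertex v ∈ S then 0 else MvPolynomial.X v

lemma sub_killHom_mem_labelIdeal (S : Set V) (f : V → L) (p : PolyRing V K) :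
    p - killHom S p ∈ labelIdeal K S f := by
  have key : (Ideal.Quotient.mkₐ K (labelIdeal K S f)).comp (killHom S) =
      Ideal.Quotient.mkₐ K (labelIdeal K S f) := by
    refine MvPolynomial.algHom_ext fun v => ?_
    by_cases hv : baseVertex v ∈ S
    · rcases v with i | i
      · have hi : i ∈ S := hv
        simpa [killHom, hi, x, baseVertex] using
          (Ideal.Quotient.eq_zero_iff_mem.2 (x_mem_labelIdeal (K := K) (f := f) hv)).symm
      · have hi : i ∈ S := hv
        simpa [killHom, hi, y, baseVertex] using
          (Ideal.Quotient.eq_zero_iff_mem.2 (y_mem_labelIdeal (K := K) (f := f) hv)).symm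
    · simp [killHom, hv]
  exact Ideal.Quotient.eq.1 (AlgHom.congr_fun key p).symm

theorem labelIdeal_eq_ker (S : Set V) (f : V → L) :
    labelIdeal K S f = RingHom.ker ((segreHom f).comp (killHom (K := K) S)) := by
  apply le_antisymm
  · refine labelIdeal_le (fun i hi => ?_) fun i j hi hj hij => ?_
    · simp [RingHom.mem_ker, killHom, x, y, baseVertex, hi]
    · simp only [RingHom.mem_ker, killHom, x, y, baseVertex, segreHom, AlgHom.comp_apply, map_sub,
        map_mul, MvPolynomial.aeval_X, Sum.elim_inl, Sum.elim_inr, id, hi, hj, if_false,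
        Sum.map_inl, Sum.map_inr, hij]
      ring
  · intro p hp
    have h1 := mem_labelIdeal_of_segreHom_eq_zero (f := f) (p := killHom S p) hp
    have h2 : labelIdeal K ∅ f ≤ labelIdeal K S f :=
      labelIdeal_le_labelIdeal_iff.2 ⟨Set.empty_subset _, fun _ _ _ _ h => h⟩
    simpa using Ideal.add_mem _ (sub_killHom_mem_labelIdeal S f p) (h2 h1)

instance labelIdeal_isPrime (S : Set V) (f : V → L) : (labelIdeal K S f).IsPrime := by
  rw [labelIdeal_eq_ker]
  exact RingHom.ker_isPrime _

end Prime

/-- Over a prime not containing `x_k`, membership of minors is transitive through `k`. -/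
lemma minor_mem_of_x_notMem {Q : Ideal (PolyRing V K)} [hQ : Q.IsPrime] {i j k : V}
    (hk : x K k ∉ Q) (hi : x K i * y K k - x K k * y K i ∈ Q)
    (hj : x K j * y K k - x K k * y K j ∈ Q) : x K i * y K j - x K j * y K i ∈ Q := by
  refine (hQ.mem_or_mem (x := x K k) ?_).resolve_left hk
  convert Q.sub_mem (Q.mul_mem_left (x K j) hi) (Q.mul_mem_left (x K i) hj) using 1
  ring

lemma minor_mem_of_y_notMem {Q : Ideal (PolyRing V K)} [hQ : Q.IsPrime] {i j k : V}
    (hk : y K k ∉ Q) (hi : x K i * y K k - x K k * y K i ∈ Q)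
    (hj : x K j * y K k - x K k * y K j ∈ Q) : x K i * y K j - x K j * y K i ∈ Q := by
  refine (hQ.mem_or_mem (x := y K k) ?_).resolve_left hk
  convert Q.sub_mem (Q.mul_mem_left (y K j) hi) (Q.mul_mem_left (y K i) hj) using 1
  ring

/-- Modulo `Q`, the column of `k` is a nonzero vector over a domain, so columns proportional to it
are proportional to each other. -/
lemma minor_mem_trans {Q : Ideal (PolyRing V K)} [Q.IsPrime] {i j k : V}
    (hk : ¬ (x K k ∈ Q ∧ y K k ∈ Q)) (hi : x K i * y K k - x K k * y K i ∈ Q)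
    (hj : x K j * y K k - x K k * y K j ∈ Q) : x K i * y K j - x K j * y K i ∈ Q := by
  by_cases hx : x K k ∈ Q
  · exact minor_mem_of_y_notMem (fun hy => hk ⟨hx, hy⟩) hi hj
  · exact minor_mem_of_x_notMem hx hi hj

/-! ### Heights of label ideals -/

section Height

variable [Finite V] {L : Type*}

lemma add_one_le_height_of_lt {A : Type*} [CommRing A] {P Q : Ideal A} [P.IsPrime] [Q.IsPrime]
    {n : ℕ} (h : P < Q) (hn : (n : ℕ∞) ≤ P.height) : ((n + 1 : ℕ) : ℕ∞) ≤ Q.height := by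
  push_cast
  exact (add_le_add_left hn 1).trans (Ideal.height_add_one_le_of_lt_of_isPrime h)

/-- Builds a descending chain of primes, one per unit of `n`. A vertex outside `S` that is not its
own representative is made a class of its own. When none is left, some `i ∈ S` leaves `S` and joins
the class of an outside vertex `j`, trading two generators for one. -/
lemma le_height_labelIdeal_of_idempotent (n : ℕ) (S : Set V) (r : V → V) (hS : S ≠ Set.univ)
    (hr : ∀ i, r (r i) = r i) (hrS : ∀ i ∉ S, r i ∉ S)
    (hn : n = 2 * S.ncard + {i | i ∉ S ∧ r i ≠ i}.ncard) :
    (n : ℕ∞) ≤ (labelIdeal K S r).height := by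
  classical
  induction n generalizing S r with
  | zero => simp
  | succ n ih =>
    by_cases hex : ∃ i, i ∉ S ∧ r i ≠ i
    · obtain ⟨i, hi, hri⟩ := hex
      let r' := Function.update r i i
      have hne : ∀ k, r k ≠ i := fun k hk => hri (by rw [← hk, hr])
      have hr' : ∀ k, k ≠ i → r' k = r k := fun k hk => Function.update_of_ne hk _ _
      have hr'i : r' i = i := Function.update_self _ _ _
      have hset : {k | k ∉ S ∧ r' k ≠ k} = {k | k ∉ S ∧ r k ≠ k} \ {i} := by
        ext k
        by_cases hk : k = i
        · subst hk; simp [hr'i]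
        · simp [hr' k hk, hk]
      have hcard := Set.ncard_sdiff_singleton_add_one
        (show i ∈ {k | k ∉ S ∧ r k ≠ k} from ⟨hi, hri⟩) (Set.toFinite _)
      have h1 := ih S r' hS
        (fun k => by
          by_cases hk : k = i
          · subst hk; rw [hr'i, hr'i]
          · rw [hr' k hk, hr' _ (hne k), hr])
        (fun k hk => by
          by_cases hki : k = i
          · subst hki; rwa [hr'i]
          · rw [hr' k hki]; exact hrS k hk)
        (by rw [hset]; omega)
      refine add_one_le_height_of_lt (P := labelIdeal K S r') ?_ h1
      refine lt_of_le_not_ge (labelIdeal_le_labelIdeal_iff.2 ⟨subset_rfl, ?_⟩) fun hle => ?_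
      · intro a b _ _ hab
        by_cases ha : a = i <;> by_cases hb : b = i
        · rw [ha, hb]
        · subst ha; rw [hr'i, hr' b hb] at hab; exact absurd hab.symm (hne b)
        · subst hb; rw [hr'i, hr' a ha] at hab; exact absurd hab (hne a)
        · rwa [hr' a ha, hr' b hb] at hab
      · have := (labelIdeal_le_labelIdeal_iff.1 hle).2 i (r i) hi (hrS i hi) (hr i).symm
        rw [hr'i, hr' _ (hne i), hr] at this
        exact hri this.symm
    · push Not at hex
      have hempty : {i | i ∉ S ∧ r i ≠ i} = ∅ := by
        ext i; simpa using hex i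
      rw [hempty, Set.ncard_empty] at hn
      obtain ⟨i, hi⟩ : S.Nonempty := by
        rw [Set.nonempty_iff_ne_empty]; rintro rfl; simp at hn
      obtain ⟨j, hj⟩ := (Set.ne_univ_iff_exists_notMem S).1 hS
      have hji : j ≠ i := fun h => hj (h ▸ hi)
      let r' := Function.update id i j
      have hr'i : r' i = j := Function.update_self _ _ _
      have hr' : ∀ k, k ≠ i → r' k = k := fun k hk => Function.update_of_ne hk _ _
      have hset : {k | k ∉ S \ {i} ∧ r' k ≠ k} = {i} := by
        ext k
        by_cases hk : k = i
        · subst hk; simp [hr'i, hji]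
        · simp [hr' k hk, hk]
      have hcard := Set.ncard_sdiff_singleton_add_one hi (Set.toFinite _)
      have h1 := ih (S \ {i}) r' (fun h => (h ▸ Set.mem_univ i : i ∈ S \ {i}).2 rfl)
        (fun k => by
          by_cases hk : k = i
          · subst hk; rw [hr'i, hr' j hji]
          · rw [hr' k hk, hr' k hk])
        (fun k hk => by
          by_cases hki : k = i
          · subst hki; rw [hr'i]; exact fun h => hj h.1
          · rwa [hr' k hki])
        (by rw [hset, Set.ncard_singleton]; omega)
      refine add_one_le_height_of_lt (P := labelIdeal K (S \ {i}) r') ?_ h1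
      refine lt_of_le_not_ge (labelIdeal_le_labelIdeal_iff.2 ⟨Set.sdiff_subset, ?_⟩) fun hle => ?_
      · intro a b ha hb hab
        rw [hr' a (fun h => ha (h ▸ hi)), hr' b (fun h => hb (h ▸ hi))] at hab
        rw [hab]
      · exact ((labelIdeal_le_labelIdeal_iff.1 hle).1 hi).2 rfl

/-- Krull's height theorem: the ideal is minimal over the variables of `S` and one minor per vertex
that is not its own representative. A smaller prime over these omits `x_{r i}`, so the remaining
minors follow by transitivity through representatives. -/
lemma height_labelIdeal_le_of_idempotent (S : Set V) (r : V → V)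
    (hr : ∀ i, r (r i) = r i) (hrS : ∀ i ∉ S, r i ∉ S) :
    (labelIdeal K S r).height ≤ ((2 * S.ncard + {i | i ∉ S ∧ r i ≠ i}.ncard : ℕ) : ℕ∞) := by
  set g : Set (PolyRing V K) := (x K '' S ∪ y K '' S) ∪
    (fun i => x K i * y K (r i) - x K (r i) * y K i) '' {i | i ∉ S ∧ r i ≠ i} with hg
  have hmin : labelIdeal K S r ∈ (Ideal.span g).minimalPrimes := by
    refine ⟨⟨inferInstance, Ideal.span_le.2 ?_⟩, ?_⟩
    · rintro p ((⟨i, hi, rfl⟩ | ⟨i, hi, rfl⟩) | ⟨i, -, rfl⟩)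
      · exact x_mem_labelIdeal hi
      · exact y_mem_labelIdeal hi
      · exact minor_mem_labelIdeal (hr i).symm
    · rintro Q ⟨hQ, hgQ⟩ hQle
      have hsub : g ⊆ Q := Ideal.span_le.1 hgQ
      refine labelIdeal_le (fun i hi => ⟨hsub (Or.inl (Or.inl ⟨i, hi, rfl⟩)),
        hsub (Or.inl (Or.inr ⟨i, hi, rfl⟩))⟩) fun i j hi hj hij => ?_
      have hmem : ∀ i ∉ S, x K i * y K (r i) - x K (r i) * y K i ∈ Q := by
        intro i hi
        by_cases hri : r i = i
        · rw [hri, sub_self]; exact Q.zero_mem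
        · exact hsub (Or.inr ⟨i, ⟨hi, hri⟩, rfl⟩)
      refine minor_mem_of_x_notMem (k := r i) (fun h => ?_) (hmem i hi) (hij ▸ hmem j hj)
      exact hrS i hi (x_mem_labelIdeal_iff.1 (hQle h))
  refine (Ideal.height_le_card_of_mem_minimalPrimes_span (Set.toFinite g) hmin).trans ?_
  have h1 := Set.ncard_union_le (x K '' S ∪ y K '' S)
    ((fun i => x K i * y K (r i) - x K (r i) * y K i) '' {i | i ∉ S ∧ r i ≠ i})
  have h2 := Set.ncard_union_le (x K '' S) (y K '' S)
  have h3 := Set.ncard_image_le (f := x K) (Set.toFinite S)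
  have h4 := Set.ncard_image_le (f := y K) (Set.toFinite S)
  have h5 := Set.ncard_image_le (f := fun i => x K i * y K (r i) - x K (r i) * y K i)
    (Set.toFinite {i | i ∉ S ∧ r i ≠ i})
  have : g.ncard ≤ 2 * S.ncard + {i | i ∉ S ∧ r i ≠ i}.ncard := by rw [hg]; omega
  exact_mod_cast this

/-- The height of a label ideal: `|V| + |S|` minus the number of labels outside `S`. -/
theorem height_labelIdeal_add {S : Set V} (hS : S ≠ Set.univ) (f : V → L) :
    (labelIdeal K S f).height + ((f '' Sᶜ).ncard : ℕ∞) = ((Nat.card V + S.ncard : ℕ) : ℕ∞) := by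
  classical
  -- `M` is a transversal of the label classes outside `S`; replacing labels by representatives in
  -- `M` makes the labelling idempotent.
  obtain ⟨M, hMS, hM⟩ := Set.exists_subset_bijOn Sᶜ f
  have hrep : ∀ i, i ∉ S → ∃ m ∈ M, f m = f i := fun i hi => hM.surjOn ⟨i, hi, rfl⟩
  let r : V → V := fun i => if h : i ∉ S then (hrep i h).choose else i
  have hrM : ∀ i ∉ S, r i ∈ M ∧ f (r i) = f i := fun i hi => by
    simp only [r, dif_pos hi]; exact (hrep i hi).choose_spec
  have hrS : ∀ i ∉ S, r i ∉ S := fun i hi => hMS (hrM i hi).1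
  have hfix : ∀ m ∈ M, r m = m := fun m hm =>
    hM.injOn (hrM m (hMS hm)).1 hm (hrM m (hMS hm)).2
  have hr : ∀ i, r (r i) = r i := fun i => by
    by_cases hi : i ∈ S
    · have : r i = i := by simp [r, hi]
      rw [this, this]
    · exact hfix _ (hrM i hi).1
  have hker : ∀ i j, i ∉ S → j ∉ S → (f i = f j ↔ r i = r j) := fun i j hi hj =>
    ⟨fun h => hM.injOn (hrM i hi).1 (hrM j hj).1 (by rw [(hrM i hi).2, (hrM j hj).2, h]),
      fun h => by rw [← (hrM i hi).2, ← (hrM j hj).2, h]⟩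
  have heq : labelIdeal K S f = labelIdeal K S r := le_antisymm
    (labelIdeal_le_labelIdeal_iff.2 ⟨subset_rfl, fun i j hi hj => (hker i j hi hj).1⟩)
    (labelIdeal_le_labelIdeal_iff.2 ⟨subset_rfl, fun i j hi hj => (hker i j hi hj).2⟩)
  have hheight : (labelIdeal K S r).height =
      ((2 * S.ncard + {i | i ∉ S ∧ r i ≠ i}.ncard : ℕ) : ℕ∞) :=
    le_antisymm (height_labelIdeal_le_of_idempotent S r hr hrS)
      (le_height_labelIdeal_of_idempotent _ S r hS hr hrS rfl)
  have hset : {i | i ∉ S ∧ r i ≠ i} = Sᶜ \ M := by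
    ext i
    simp only [Set.mem_ofPred_eq, Set.mem_sdiff, Set.mem_compl_iff]
    refine and_congr_right fun hi => not_congr ⟨fun h => h ▸ (hrM i hi).1, hfix i⟩
  have h1 := Set.ncard_sdiff_add_ncard_of_subset hMS (Set.toFinite _)
  have h2 := Set.ncard_add_ncard_compl S
  have h3 : (f '' Sᶜ).ncard = M.ncard := by
    rw [← hM.image_eq, hM.injOn.ncard_image]
  rw [heq, hheight, hset, h3]
  norm_cast
  omega

end Height

/-! ### Counting classes of refinements -/

section Cardinality

variable {L L' : Type*}

lemma ncard_image_le_of_refines [Finite V] {f : V → L} {g : V → L'} {A : Set V}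
    (h : ∀ a ∈ A, ∀ b ∈ A, g a = g b → f a = f b) : (f '' A).ncard ≤ (g '' A).ncard := by
  obtain ⟨M, hMA, hM⟩ := Set.exists_subset_bijOn A f
  rw [← hM.image_eq, hM.injOn.ncard_image, ← Set.InjOn.ncard_image (f := g) (s := M)
    fun a ha b hb hab => hM.injOn ha hb (h a (hMA ha) b (hMA hb) hab)]
  exact Set.ncard_le_ncard (Set.image_mono hMA) (Set.toFinite _)

/-- A refinement of a labelling with no more labels has the same fibres. -/
lemma eq_of_refines_of_ncard_image_le [Finite V] {f : V → L} {g : V → L'} {A : Set V}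
    (h : ∀ a ∈ A, ∀ b ∈ A, f a = f b → g a = g b) (hc : (f '' A).ncard ≤ (g '' A).ncard)
    {a b : V} (ha : a ∈ A) (hb : b ∈ A) (hab : g a = g b) : f a = f b := by
  obtain ⟨M, hMA, hM⟩ := Set.exists_subset_bijOn A g
  have hinj : Set.InjOn f M := fun a ha b hb hab =>
    hM.injOn ha hb (h a (hMA ha) b (hMA hb) hab)
  -- By the count, a transversal for the coarser `g` already meets every class of `f`.
  have himg : f '' M = f '' A := by
    refine Set.eq_of_subset_of_ncard_le (Set.image_mono hMA) ?_ (Set.toFinite _)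
    rwa [hinj.ncard_image, ← hM.injOn.ncard_image, hM.image_eq]
  obtain ⟨m, hm, hma⟩ : f a ∈ f '' M := himg ▸ ⟨a, ha, rfl⟩
  obtain ⟨m', hm', hmb⟩ : f b ∈ f '' M := himg ▸ ⟨b, hb, rfl⟩
  have : m = m' := hM.injOn hm hm' <| by
    rw [h m (hMA hm) a ha hma, h m' (hMA hm') b hb hmb, hab]
  rw [← hma, ← hmb, this]

end Cardinality

/-! ### Components of vertex-deleted graphs -/

section Components

variable {G : SimpleGraph V} {S T : Set V}

open Classical in
/-- The labelling of the vertices outside `S` by the connected components of `G - S`. -/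
def compLabel (G : SimpleGraph V) (S : Set V) (i : V) :
    Option (G.induce Sᶜ).ConnectedComponent :=
  if h : i ∈ Sᶜ then some ((G.induce Sᶜ).connectedComponentMk ⟨i, h⟩) else none

lemma compLabel_of_notMem {i : V} (hi : i ∈ Sᶜ) :
    compLabel G S i = some ((G.induce Sᶜ).connectedComponentMk ⟨i, hi⟩) := dif_pos hi

lemma compLabel_eq_of_adj {i j : V} (hi : i ∉ S) (hj : j ∉ S) (h : G.Adj i j) :
    compLabel G S i = compLabel G S j := by
  rw [compLabel_of_notMem hi, compLabel_of_notMem hj, Option.some_inj,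
    SimpleGraph.ConnectedComponent.eq]
  exact SimpleGraph.Adj.reachable (G := G.induce Sᶜ) (u := ⟨i, hi⟩) (v := ⟨j, hj⟩) h

/-- A predicate propagating along edges outside `S` propagates along components of `G - S`. -/
lemma of_compLabel_eq {P : (↥(Sᶜ)) → Prop}
    (hP : ∀ a b : ↥(Sᶜ), G.Adj a b → P a → P b) {i j : V} (hi : i ∉ S) (hj : j ∉ S)
    (h : compLabel G S i = compLabel G S j) : P ⟨i, hi⟩ → P ⟨j, hj⟩ := by
  rw [compLabel_of_notMem hi, compLabel_of_notMem hj, Option.some_inj,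
    SimpleGraph.ConnectedComponent.eq] at h
  obtain ⟨w⟩ := h
  generalize (⟨i, hi⟩ : ↥(Sᶜ)) = a, (⟨j, hj⟩ : ↥(Sᶜ)) = b at w ⊢
  induction w with
  | nil => exact id
  | cons hadj _ ih => exact fun hp => ih (hP _ _ hadj hp)

lemma map_eq_of_compLabel_eq {L : Type*} {g : ↥(Sᶜ) → L}
    (hg : ∀ a b : ↥(Sᶜ), G.Adj a b → g a = g b) {i j : V} (hi : i ∉ S) (hj : j ∉ S)
    (h : compLabel G S i = compLabel G S j) : g ⟨i, hi⟩ = g ⟨j, hj⟩ :=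
  (of_compLabel_eq (P := fun a => g a = g ⟨i, hi⟩) (fun a b hab ha => (hg a b hab).symm.trans ha)
    hi hj h rfl).symm

lemma compLabel_mono (hST : S ⊆ T) {i j : V} (hi : i ∉ T) (hj : j ∉ T)
    (h : compLabel G T i = compLabel G T j) : compLabel G S i = compLabel G S j :=
  map_eq_of_compLabel_eq (g := fun a : ↥(Tᶜ) => compLabel G S a)
    (fun a b hab => compLabel_eq_of_adj (fun h => a.2 (hST h)) (fun h => b.2 (hST h)) hab) hi hj h

lemma numComponents_eq (G : SimpleGraph V) (S : Set V) :
    numComponents G S = (compLabel G S '' Sᶜ).ncard := by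
  have : compLabel G S '' Sᶜ = some '' Set.univ := by
    ext o
    constructor
    · rintro ⟨i, hi, rfl⟩
      exact ⟨_, trivial, (compLabel_of_notMem hi).symm⟩
    · rintro ⟨C, -, rfl⟩
      obtain ⟨⟨i, hi⟩, rfl⟩ := C.exists_rep
      exact ⟨i, hi, compLabel_of_notMem hi⟩
  rw [this, (Option.some_injective _).injOn.ncard_image, Set.ncard_univ, numComponents]

lemma primeIdeal_eq_labelIdeal (G : SimpleGraph V) (S : Set V) :
    primeIdeal K G S = labelIdeal K S (compLabel G S) := by
  apply le_antisymm
  · refine sup_le (Ideal.span_le.2 ?_) (iSup_le fun C => Ideal.span_le.2 ?_)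
    · rintro p ⟨i, hi, rfl | rfl⟩
      · exact x_mem_labelIdeal hi
      · exact y_mem_labelIdeal hi
    · rintro p ⟨i, j, ⟨-, ⟨⟨i, hi⟩, hiC, rfl⟩, ⟨⟨j, hj⟩, hjC, rfl⟩⟩, rfl⟩
      rw [SimpleGraph.ConnectedComponent.mem_supp_iff] at hiC hjC
      exact minor_mem_labelIdeal (by
        rw [compLabel_of_notMem hi, compLabel_of_notMem hj, hiC, hjC])
  · refine labelIdeal_le (fun i hi => ⟨Ideal.mem_sup_left (Ideal.subset_span ⟨i, hi, Or.inl rfl⟩),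
      Ideal.mem_sup_left (Ideal.subset_span ⟨i, hi, Or.inr rfl⟩)⟩) fun i j hi hj hij => ?_
    by_cases hne : i = j
    · rw [hne, sub_self]; exact Ideal.zero_mem _
    rw [compLabel_of_notMem hi, compLabel_of_notMem hj, Option.some_inj] at hij
    refine Ideal.mem_sup_right (Ideal.mem_iSup_of_mem
      ((G.induce Sᶜ).connectedComponentMk ⟨i, hi⟩) (Ideal.subset_span ⟨i, j, ⟨hne, ?_, ?_⟩, rfl⟩))
    · exact ⟨⟨i, hi⟩, rfl, rfl⟩
    · exact ⟨⟨j, hj⟩, hij.symm, rfl⟩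

/-- If deleting `i` increases the number of components, then `i` is joined to two of the new
components. -/
lemma exists_adj_of_numComponents_lt [Finite V] {i : V}
    (h : numComponents G (S \ {i}) < numComponents G S) :
    ∃ u v, u ∉ S ∧ v ∉ S ∧ G.Adj i u ∧ G.Adj i v ∧ compLabel G S u ≠ compLabel G S v := by
  classical
  by_contra hcon
  push Not at hcon
  refine h.not_ge ?_
  rw [numComponents_eq, numComponents_eq]
  refine (ncard_image_le_of_refines (g := compLabel G (S \ {i})) ?_).trans
    (Set.ncard_le_ncard (Set.image_mono (Set.compl_subset_compl.2 Set.sdiff_subset))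
      (Set.toFinite _))
  intro a ha b hb hab
  by_cases hi : i ∈ S
  swap
  · rwa [Set.sdiff_singleton_eq_self hi] at hab
  -- Extends the labels of `G - S` to `i` by the common label of its neighbours outside `S` (`none`
  -- if there are none). By `hcon`, `F` is constant along edges of `G - (S \ {i})`.
  let F : V → Option (G.induce Sᶜ).ConnectedComponent := fun k =>
    if k = i then (if h : ∃ u, u ∉ S ∧ G.Adj i u then compLabel G S h.choose else none)
    else compLabel G S k
  have hF : ∀ k, k ∉ S → F k = compLabel G S k := fun k hk =>
    if_neg fun h : k = i => hk (h ▸ hi)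
  have hFi : ∀ k, k ∉ S → G.Adj i k → F i = F k := by
    intro k hk hik
    have hex : ∃ u, u ∉ S ∧ G.Adj i u := ⟨k, hk, hik⟩
    rw [hF k hk]
    simp only [F, if_true, dif_pos hex]
    exact hcon _ _ hex.choose_spec.1 hk hex.choose_spec.2 hik
  have hout : ∀ k, k ∉ S \ {i} → k = i ∨ k ∉ S := fun k hk => by
    by_contra hc
    push Not at hc
    exact hk ⟨hc.2, hc.1⟩
  have := map_eq_of_compLabel_eq (g := fun k : ↥((S \ {i})ᶜ) => F k) (fun k l hkl => ?_)
    (fun h => ha h.1) (fun h => hb h.1) hab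
  · simpa [hF a ha, hF b hb] using this
  · obtain ⟨k, hk⟩ := k
    obtain ⟨l, hl⟩ := l
    dsimp only at hkl ⊢
    rcases hout k hk with rfl | hk' <;> rcases hout l hl with rfl | hl'
    · rfl
    · exact hFi l hl' hkl
    · exact (hFi k hk' hkl.symm).symm
    · rw [hF k hk', hF l hl', compLabel_eq_of_adj hk' hl' hkl]

lemma IsCutSet.exists_adj [Finite V] (hS : IsCutSet G S) {i : V} (hi : i ∈ S) :
    ∃ u v, u ∉ S ∧ v ∉ S ∧ G.Adj i u ∧ G.Adj i v ∧ compLabel G S u ≠ compLabel G S v :=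
  exists_adj_of_numComponents_lt (hS i hi)

/-- The neighbour `u` keeps the component of `t` represented after `t` is discarded. -/
lemma compLabel_image_compl_insert {t u : V} (ht : t ∉ S) (hu : u ∉ insert t S)
    (htu : G.Adj t u) : compLabel G S '' (insert t S)ᶜ = compLabel G S '' Sᶜ := by
  refine (Set.image_mono (Set.compl_subset_compl.2 (Set.subset_insert t S))).antisymm ?_
  rintro _ ⟨i, hi, rfl⟩
  by_cases hit : i = t
  · subst hit
    exact ⟨u, hu, (compLabel_eq_of_adj ht (fun h => hu (Or.inr h)) htu).symm⟩
  · exact ⟨i, fun h => h.elim hit hi, rfl⟩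

/-- If `i` and `j` are connected in `G - T`, but not in `G - T - s`, then `s` has a neighbour in the
component of `i` in `G - T - s`. -/
lemma exists_adj_of_compLabel_insert_ne {s i j : V} (hi : i ∉ insert s T) (hj : j ∉ insert s T)
    (h : compLabel G T i = compLabel G T j)
    (hne : compLabel G (insert s T) i ≠ compLabel G (insert s T) j) :
    ∃ w, w ∉ insert s T ∧ G.Adj s w ∧
      compLabel G (insert s T) w = compLabel G (insert s T) i := by
  by_contra hcon
  push Not at hcon
  have hT : ∀ k, k ∉ insert s T → k ∉ T := fun k hk h => hk (Or.inr h)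
  -- Without such a `w`, a walk in `G - T` from `i` can never step onto `s`, so it stays in one
  -- component of `G - T - s`.
  refine hne (of_compLabel_eq (P := fun k : ↥(Tᶜ) => (k : V) ∉ insert s T ∧
    compLabel G (insert s T) k = compLabel G (insert s T) i) ?_ (hT i hi) (hT j hj) h
    ⟨hi, rfl⟩).2.symm
  rintro ⟨k, hk⟩ ⟨l, hl⟩ hkl ⟨hk', hki⟩
  have hls : l ≠ s := by
    rintro rfl
    exact hcon k hk' hkl.symm hki
  have hl' : l ∉ insert s T := fun h => h.elim hls hl
  exact ⟨hl', (compLabel_eq_of_adj hk' hl' hkl).symm.trans hki⟩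

/-- With `compLabel_induce_eq_of_insert`, identifies components of `(G - S) - t` with those of `G -
(S ∪ {t})`, since cut vertices of `G - S` live in the induced graph. -/
lemma compLabel_insert_eq_of_induce {t : ↥(Sᶜ)} {i j : V} (hi : i ∉ insert (t : V) S)
    (hj : j ∉ insert (t : V) S)
    (h : compLabel (G.induce Sᶜ) {t} ⟨i, fun h => hi (Or.inr h)⟩ =
      compLabel (G.induce Sᶜ) {t} ⟨j, fun h => hj (Or.inr h)⟩) :
    compLabel G (insert (t : V) S) i = compLabel G (insert (t : V) S) j := by
  have hne : ∀ a : ↥(({t} : Set ↥(Sᶜ))ᶜ), ((a : ↥(Sᶜ)) : V) ∉ insert (t : V) S := fun a ha =>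
    ha.elim (fun h => a.2 (Subtype.ext h)) a.1.2
  exact map_eq_of_compLabel_eq
    (g := fun a : ↥(({t} : Set ↥(Sᶜ))ᶜ) => compLabel G (insert (t : V) S) ((a : ↥(Sᶜ)) : V))
    (fun a b hab => compLabel_eq_of_adj (hne a) (hne b) hab)
    (fun h => hi (Or.inl (congrArg Subtype.val h))) (fun h => hj (Or.inl (congrArg Subtype.val h))) h

lemma compLabel_induce_eq_of_insert {t : ↥(Sᶜ)} {i j : V} (hi : i ∉ insert (t : V) S)
    (hj : j ∉ insert (t : V) S)
    (h : compLabel G (insert (t : V) S) i = compLabel G (insert (t : V) S) j) :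
    compLabel (G.induce Sᶜ) {t} ⟨i, fun h => hi (Or.inr h)⟩ =
      compLabel (G.induce Sᶜ) {t} ⟨j, fun h => hj (Or.inr h)⟩ :=
  map_eq_of_compLabel_eq (g := fun a : ↥((insert (t : V) S)ᶜ) =>
      compLabel (G.induce Sᶜ) {t} ⟨a, fun h => a.2 (Or.inr h)⟩)
    (fun a b hab => compLabel_eq_of_adj (fun h => a.2 (Or.inl (congrArg Subtype.val h)))
      (fun h => b.2 (Or.inl (congrArg Subtype.val h))) hab) hi hj h

/-- Deleting a non-isolated vertex of `G - S` that is not a cut vertex does not disconnect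
anything. -/
lemma compLabel_insert_eq_of_not_isCutVertex [Finite V] {t : ↥(Sᶜ)}
    (ht : ¬ IsCutVertex (G.induce Sᶜ) t) {u : V} (hu : u ∉ insert (t : V) S) (htu : G.Adj t u)
    {i j : V} (hi : i ∉ insert (t : V) S) (hj : j ∉ insert (t : V) S)
    (h : compLabel G S i = compLabel G S j) :
    compLabel G (insert (t : V) S) i = compLabel G (insert (t : V) S) j := by
  have hout : ∀ k, k ∉ insert (t : V) S → k ∈ Sᶜ := fun k hk h => hk (Or.inr h)
  have hne : ∀ k (hk : k ∉ insert (t : V) S),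
      (⟨k, hout k hk⟩ : ↥(Sᶜ)) ∉ insert t (∅ : Set ↥(Sᶜ)) := fun k hk h =>
    hk (Or.inl (congrArg Subtype.val (by simpa using h)))
  refine compLabel_insert_eq_of_induce hi hj ?_
  have hcount : numComponents (G.induce Sᶜ) {t} ≤ numComponents (G.induce Sᶜ) ∅ := by
    have : ¬ numComponents (G.induce Sᶜ) ({t} \ {t}) < numComponents (G.induce Sᶜ) {t} :=
      fun hlt => ht fun i hi => by rwa [Set.mem_singleton_iff.1 hi]
    rwa [Set.sdiff_self, not_lt] at this
  -- The neighbour `u` lets both counts run over the vertices other than `t`; a refinement with no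
  -- more classes is then an equality.
  rw [numComponents_eq, numComponents_eq, ← compLabel_image_compl_insert (t := t)
    (u := ⟨u, hout u hu⟩) (Set.notMem_empty t) (hne u hu) htu, insert_empty_eq] at hcount
  simp only [insert_empty_eq] at hne
  refine eq_of_refines_of_ncard_image_le
    (fun a ha b hb hab => compLabel_mono (Set.empty_subset _) ha hb hab) hcount
    (hne i hi) (hne j hj) ?_
  exact map_eq_of_compLabel_eq (g := fun a : ↥(Sᶜ) => compLabel (G.induce Sᶜ) ∅ a)
    (fun a b hab => compLabel_eq_of_adj (Set.notMem_empty a) (Set.notMem_empty b) hab)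
    (hout i hi) (hout j hj) h

/-- If `S - s = T - t`, the set `S` is a cut set and `t` is a cut vertex of `G - S`, then the
components of `G - S` and of `G - T` induce different partitions outside `S ∪ T`. -/
lemma not_forall_compLabel_iff_of_isCutVertex [Finite V] (hS : IsCutSet G S) {s : V} (hsS : s ∈ S)
    (hsT : s ∉ T) {t : ↥(Sᶜ)} (hU : insert (t : V) S = insert s T)
    (ht : IsCutVertex (G.induce Sᶜ) t) :
    ¬ ∀ i j, i ∉ insert (t : V) S → j ∉ insert (t : V) S →
      (compLabel G S i = compLabel G S j ↔ compLabel G T i = compLabel G T j) := by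
  intro hiff
  have hout : ∀ {k}, k ∉ insert (t : V) S → k ∉ S := fun hk h => hk (Or.inr h)
  have houtT : ∀ {k}, k ∉ insert (t : V) S → k ∉ T := fun hk h => hk (hU ▸ Or.inr h)
  obtain ⟨⟨u, huS⟩, ⟨v, hvS⟩, hu, hv, htu, htv, huv⟩ := IsCutSet.exists_adj ht rfl
  replace hu : u ∉ insert (t : V) S := fun h => h.elim (fun h => hu (Subtype.ext h)) huS
  replace hv : v ∉ insert (t : V) S := fun h => h.elim (fun h => hv (Subtype.ext h)) hvS
  replace huv : compLabel G (insert (t : V) S) u ≠ compLabel G (insert (t : V) S) v :=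
    fun h => huv (compLabel_induce_eq_of_insert hu hv h)
  have hut : compLabel G S u = compLabel G S t := (compLabel_eq_of_adj t.2 huS htu).symm
  have hvt : compLabel G S v = compLabel G S t := (compLabel_eq_of_adj t.2 hvS htv).symm
  -- Equal partitions would connect `u` and `v` in `G - T`, necessarily through `s`; so `s` has a
  -- neighbour in the component of `t` in `G - S`.
  obtain ⟨w, hw, hsw, hwu⟩ : ∃ w, w ∉ insert (t : V) S ∧ G.Adj s w ∧
      compLabel G S w = compLabel G S t := by
    have hTuv := (hiff u v hu hv).1 (hut.trans hvt.symm)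
    rw [hU] at huv hu hv
    obtain ⟨w, hw, hsw, hwu⟩ := exists_adj_of_compLabel_insert_ne hu hv hTuv huv
    rw [← hU] at hw hwu hu
    exact ⟨w, hw, hsw, (compLabel_mono (Set.subset_insert _ _) hw hu hwu).trans hut⟩
  -- If a neighbour of `s` happens to be `t`, the vertex `w` replaces it without changing the
  -- component.
  have hrepl : ∀ c, c ∉ S → G.Adj s c → ∃ c', c' ∉ insert (t : V) S ∧ G.Adj s c' ∧
      compLabel G S c' = compLabel G S c := by
    intro c hc hsc
    by_cases hct : c = t
    · exact ⟨w, hw, hsw, hct ▸ hwu⟩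
    · exact ⟨c, fun h => h.elim hct hc, hsc, rfl⟩
  -- `s` touches two components of `G - S`, but it merges them in `G - T`: the partitions differ.
  obtain ⟨c, d, hc, hd, hsc, hsd, hcd⟩ := hS.exists_adj hsS
  obtain ⟨c', hc', hsc', hcc'⟩ := hrepl c hc hsc
  obtain ⟨d', hd', hsd', hdd'⟩ := hrepl d hd hsd
  refine hcd ?_
  rw [← hcc', ← hdd', hiff c' d' hc' hd', ← compLabel_eq_of_adj hsT (houtT hc') hsc',
    compLabel_eq_of_adj hsT (houtT hd') hsd']

end Components

/-! ### Cut sets give minimal primes -/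

section MinimalPrimes

variable {G : SimpleGraph V} {S T : Set V}

lemma binomialEdgeIdeal_le_labelIdeal (G : SimpleGraph V) (S : Set V) :
    binomialEdgeIdeal K G ≤ labelIdeal K S (compLabel G S) := by
  refine Ideal.span_le.2 ?_
  rintro p ⟨i, j, hij, rfl⟩
  by_cases hi : i ∈ S
  · exact minor_mem_of_left j (x_mem_labelIdeal hi) (y_mem_labelIdeal hi)
  by_cases hj : j ∈ S
  · exact minor_mem_of_right i (x_mem_labelIdeal hj) (y_mem_labelIdeal hj)
  exact minor_mem_labelIdeal (compLabel_eq_of_adj hi hj hij)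

/-- Edge minors lie in `Q`, and they compose along walks avoiding the vertices whose two variables
both lie in `Q`. -/
lemma minor_mem_of_compLabel_eq {Q : Ideal (PolyRing V K)} [Q.IsPrime]
    (hQ : binomialEdgeIdeal K G ≤ Q) {i j : V} (hi : i ∉ {k | x K k ∈ Q ∧ y K k ∈ Q})
    (hj : j ∉ {k | x K k ∈ Q ∧ y K k ∈ Q})
    (h : compLabel G {k | x K k ∈ Q ∧ y K k ∈ Q} i = compLabel G {k | x K k ∈ Q ∧ y K k ∈ Q} j) :
    x K i * y K j - x K j * y K i ∈ Q := by
  refine of_compLabel_eq (G := G)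
    (P := fun k => x K i * y K (k : V) - x K (k : V) * y K i ∈ Q) ?_ hi hj h ?_
  · rintro ⟨k, hk⟩ ⟨l, hl⟩ hkl hik
    exact minor_mem_trans hk hik (hQ (Ideal.subset_span ⟨l, k, hkl.symm, rfl⟩))
  · simp

theorem labelIdeal_mem_minimalPrimes [Finite V] (hS : IsCutSet G S) :
    labelIdeal K S (compLabel G S) ∈ (binomialEdgeIdeal K G).minimalPrimes := by
  refine ⟨⟨inferInstance, binomialEdgeIdeal_le_labelIdeal G S⟩, ?_⟩
  rintro Q ⟨hQ, hGQ⟩ hQS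
  set Z : Set V := {k | x K k ∈ Q ∧ y K k ∈ Q} with hZ
  have hminor : ∀ i j, i ∉ Z → j ∉ Z → compLabel G Z i = compLabel G Z j →
      x K i * y K j - x K j * y K i ∈ Q := fun i j hi hj h => minor_mem_of_compLabel_eq hGQ hi hj h
  have hZS : Z ⊆ S := fun k hk => x_mem_labelIdeal_iff.1 (hQS hk.1)
  have hSZ : S ⊆ Z := by
    -- A vertex of `S` outside `Z` would glue two components of `G - S` touching it, putting a minor
    -- between them into `Q`, hence into the label ideal of `S`.
    intro i hi
    by_contra hiZ
    obtain ⟨u, v, hu, hv, hiu, hiv, huv⟩ := hS.exists_adj hi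
    have huZ : u ∉ Z := fun h => hu (hZS h)
    have hvZ : v ∉ Z := fun h => hv (hZS h)
    refine huv ((minor_mem_labelIdeal_iff hu hv).1 (hQS (hminor u v huZ hvZ ?_)))
    rw [← compLabel_eq_of_adj hiZ huZ hiu, compLabel_eq_of_adj hiZ hvZ hiv]
  rw [← hZS.antisymm hSZ]
  exact labelIdeal_le (fun i hi => hi) hminor

end MinimalPrimes

/-! ### Heights of sums and adjacency -/

section DualGraph

/-- For an unmixed ideal, adjacency in the dual graph only involves the height of the sum. -/
lemma dualGraph_adj_iff {A : Type*} [CommRing A] {I : Ideal A} (hI : IsUnmixed I)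
    (p q : I.minimalPrimes) :
    (dualGraph I).Adj p q ↔ p ≠ q ∧ (p.1 ⊔ q.1).height = p.1.height + 1 := by
  have h : ∀ p : I.minimalPrimes, p.1.height = I.height := fun p => by
    rw [I.height_eq_inf_minimalPrimes]
    exact le_antisymm (le_iInf₂ fun q hq => (hI _ p.2 q hq).le) (iInf₂_le p.1 p.2)
  exact ⟨fun hadj => ⟨hadj.1, hadj.2.1⟩, fun hadj => ⟨hadj.1, hadj.2, h p, h q⟩⟩

/-- Choose `Q` above the sum with height `ht P + 1`: a prime strictly between `P` or `P'` and `Q`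
would push the height of `Q` to at least `ht P + 2`. -/
lemma exists_isPrime_of_height_sup {A : Type*} [CommRing A] [IsNoetherianRing A] {P P' : Ideal A}
    [P.IsPrime] (hPP' : P.height = P'.height) (h : (P ⊔ P').height = P.height + 1) :
    ∃ Q : Ideal A, Q.IsPrime ∧ P ≤ Q ∧ P' ≤ Q ∧
      ∀ R : Ideal A, R.IsPrime → P < R ∨ P' < R ∧ P'.IsPrime → R ≤ Q → R = Q := by
  obtain ⟨n, hn⟩ := ENat.ne_top_iff_exists.1 (P.height_ne_top Ideal.IsPrime.ne_top')
  obtain ⟨Q, hQ, hle, hQn⟩ := Ideal.exists_isPrime_height_eq (n := n + 1) (by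
    rw [h, ← hn]; norm_cast)
  refine ⟨Q, hQ, le_sup_left.trans hle, le_sup_right.trans hle, fun R hR hPR hRQ => ?_⟩
  refine hRQ.eq_of_not_lt fun hlt => ?_
  have h1 : ((n + 1 : ℕ) : ℕ∞) ≤ R.height := by
    rcases hPR with hPR | ⟨hPR, _⟩
    · exact add_one_le_height_of_lt hPR hn.le
    · exact add_one_le_height_of_lt hPR (hn.trans hPP').le
  have h2 := add_one_le_height_of_lt hlt h1
  rw [hQn, Nat.cast_le] at h2
  omega

variable {G : SimpleGraph V} {S T : Set V}

lemma labelIdeal_lt_insert {L : Type*} {f : V → L} {t : V} (ht : t ∉ S) :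
    labelIdeal K S f < labelIdeal K (insert t S) f := by
  refine lt_of_le_not_ge (labelIdeal_le_labelIdeal_iff.2
    ⟨Set.subset_insert _ _, fun _ _ _ _ h => h⟩) fun h => ht ?_
  exact (labelIdeal_le_labelIdeal_iff.1 h).1 (Set.mem_insert _ _)

lemma labelIdeal_insert_le {L : Type*} {f : V → L} {t : V} {Q : Ideal (PolyRing V K)}
    (hS : labelIdeal K S f ≤ Q) (hx : x K t ∈ Q) (hy : y K t ∈ Q) :
    labelIdeal K (insert t S) f ≤ Q := by
  refine labelIdeal_le ?_ fun i j _ _ h => hS (minor_mem_labelIdeal h)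
  rintro i (rfl | hi)
  · exact ⟨hx, hy⟩
  · exact ⟨hS (x_mem_labelIdeal hi), hS (y_mem_labelIdeal hi)⟩

variable [Finite V]

/-- For `t ∈ T \ S` the prime `Q` must be the ideal of `insert t S`, which omits `x_{t'}` for a
second `t' ∈ T \ S`, although `Q` contains it. -/
lemma height_sup_ne_of_two_mem {L L' : Type*} {f : V → L} {g : V → L'}
    (hh : (labelIdeal K S f).height = (labelIdeal K T g).height) (hcard : 1 < (T \ S).ncard) :
    (labelIdeal K S f ⊔ labelIdeal K T g).height ≠ (labelIdeal K S f).height + 1 := by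
  intro h
  obtain ⟨Q, hQ, hSQ, hTQ, hmax⟩ := exists_isPrime_of_height_sup hh h
  obtain ⟨t, ht, t', ht', hne⟩ := (Set.one_lt_ncard (Set.toFinite _)).1 hcard
  have := hmax (labelIdeal K (insert t S) f) inferInstance (Or.inl (labelIdeal_lt_insert ht.2))
    (labelIdeal_insert_le hSQ (hTQ (x_mem_labelIdeal ht.1)) (hTQ (y_mem_labelIdeal ht.1)))
  have hx : x K t' ∈ labelIdeal K (insert t S) f := this ▸ hTQ (x_mem_labelIdeal ht'.1)
  exact (x_mem_labelIdeal_iff.1 hx).elim (fun h => hne h.symm) ht'.2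

/-- If `P_S + P_T` has height `ht P_S + 1`, then the components of `G - S` and `G - T` induce the
same partition outside `S ∪ T = S ∪ {t} = T ∪ {s}`. -/
lemma label_eq_iff_of_height_sup {L L' : Type*} {f : V → L} {g : V → L'}
    (hh : (labelIdeal K S f).height = (labelIdeal K T g).height)
    (h : (labelIdeal K S f ⊔ labelIdeal K T g).height = (labelIdeal K S f).height + 1)
    {s t : V} (hsS : s ∈ S) (hsT : s ∉ T) (htT : t ∈ T) (htS : t ∉ S)
    {i j : V} (hi : i ∉ insert t S) (hj : j ∉ insert t S) (hU : insert t S = insert s T) :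
    f i = f j ↔ g i = g j := by
  obtain ⟨Q, hQ, hSQ, hTQ, hmax⟩ := exists_isPrime_of_height_sup hh h
  have h1 := hmax (labelIdeal K (insert t S) f) inferInstance (Or.inl (labelIdeal_lt_insert htS))
    (labelIdeal_insert_le hSQ (hTQ (x_mem_labelIdeal htT)) (hTQ (y_mem_labelIdeal htT)))
  have h2 := hmax (labelIdeal K (insert s T) g) inferInstance
    (Or.inr ⟨labelIdeal_lt_insert hsT, inferInstance⟩)
    (labelIdeal_insert_le hTQ (hSQ (x_mem_labelIdeal hsS)) (hSQ (y_mem_labelIdeal hsS)))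
  rw [← minor_mem_labelIdeal_iff (K := K) hi hj, h1, ← h2,
    minor_mem_labelIdeal_iff (hU ▸ hi) (hU ▸ hj)]

/-- The sum lies strictly above `P_S` and inside the label ideal of `insert t S` with the labels of
`S`. The latter has height `ht P_S + 1`: the set grows by one, and `u` preserves the number of
labels. -/
lemma height_sup_eq {t u : V} (ht : t ∉ S) (hu : u ∉ insert t S) (htu : G.Adj t u)
    (htT : t ∈ T) (hTS : T ⊆ insert t S)
    (hrel : ∀ i j, i ∉ insert t S → j ∉ insert t S → compLabel G T i = compLabel G T j →
      compLabel G S i = compLabel G S j) :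
    (labelIdeal K S (compLabel G S) ⊔ labelIdeal K T (compLabel G T)).height =
      (labelIdeal K S (compLabel G S)).height + 1 := by
  have hSu : S ≠ Set.univ := fun h => ht (h ▸ trivial)
  have hUu : insert t S ≠ Set.univ := fun h => hu (h ▸ trivial)
  have hlt : labelIdeal K S (compLabel G S) <
      labelIdeal K S (compLabel G S) ⊔ labelIdeal K T (compLabel G T) := by
    refine lt_of_le_not_ge le_sup_left fun h => ht ?_
    exact x_mem_labelIdeal_iff.1 (h (Ideal.mem_sup_right (x_mem_labelIdeal (K := K) htT)))
  have hfin := (labelIdeal K S (compLabel G S)).height_ne_top Ideal.IsPrime.ne_top'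
  refine le_antisymm ?_ ((ENat.add_one_le_iff hfin).2 (Ideal.height_strict_mono_of_isPrime hlt))
  refine (Ideal.height_mono (sup_le (labelIdeal_lt_insert ht).le
    (labelIdeal_le_labelIdeal_iff.2 ⟨hTS, hrel⟩))).trans (le_of_eq ?_)
  have h1 := height_labelIdeal_add (K := K) hSu (compLabel G S)
  have h2 := height_labelIdeal_add (K := K) hUu (compLabel G S)
  have hfin' := (labelIdeal K (insert t S) (compLabel G S)).height_ne_top Ideal.IsPrime.ne_top'
  rw [compLabel_image_compl_insert ht hu htu, Set.ncard_insert_of_notMem ht (Set.toFinite _)] at h2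
  obtain ⟨a, ha⟩ := ENat.ne_top_iff_exists.1 hfin
  obtain ⟨b, hb⟩ := ENat.ne_top_iff_exists.1 hfin'
  rw [← ha] at h1 ⊢
  rw [← hb] at h2 ⊢
  norm_cast at h1 h2 ⊢
  omega

/-- Cut sets of the same size with primes of the same height have the same number of components. -/
lemma numComponents_eq_of_height_eq (hS : S ≠ Set.univ) (hT : T ≠ Set.univ)
    (hh : (labelIdeal K S (compLabel G S)).height = (labelIdeal K T (compLabel G T)).height)
    (hcard : S.ncard = T.ncard) : numComponents G S = numComponents G T := by
  have h1 := height_labelIdeal_add (K := K) hS (compLabel G S)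
  have h2 := height_labelIdeal_add (K := K) hT (compLabel G T)
  rw [← hcard, ← h1, ← hh] at h2
  have hfin := (labelIdeal K S (compLabel G S)).height_ne_top Ideal.IsPrime.ne_top'
  rw [numComponents_eq, numComponents_eq]
  obtain ⟨a, ha⟩ := ENat.ne_top_iff_exists.1 hfin
  rw [← ha] at h2
  norm_cast at h2
  omega

end DualGraph

end BinomialEdge

end

/-! ### The main theorem -/

open BinomialEdge in
theorem theorem4p2 {V : Type*} [Finite V] (K : Type*) [Field K] (G : SimpleGraph V)
    (hG : BinomialEdge.IsUnmixed (BinomialEdge.binomialEdgeIdeal K G))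
    (S T : Set V) (hS : BinomialEdge.IsCutSet G S) (hT : BinomialEdge.IsCutSet G T)
    (hST : S.ncard ≤ T.ncard) :
    ∃ (pS : BinomialEdge.primeIdeal K G S ∈ (BinomialEdge.binomialEdgeIdeal K G).minimalPrimes)
      (pT : BinomialEdge.primeIdeal K G T ∈ (BinomialEdge.binomialEdgeIdeal K G).minimalPrimes),
      (1 < (T \ S).ncard →
        ¬ (BinomialEdge.dualGraph (BinomialEdge.binomialEdgeIdeal K G)).Adj ⟨_, pS⟩ ⟨_, pT⟩) ∧
      ((T \ S).ncard = 1 → S ⊆ T →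
        (BinomialEdge.dualGraph (BinomialEdge.binomialEdgeIdeal K G)).Adj ⟨_, pS⟩ ⟨_, pT⟩) ∧
      (∀ t : ↥(Sᶜ), T \ S = {(t : V)} → ¬ S ⊆ T →
        ((BinomialEdge.dualGraph (BinomialEdge.binomialEdgeIdeal K G)).Adj ⟨_, pS⟩ ⟨_, pT⟩ ↔
          ¬ BinomialEdge.IsCutVertex (G.induce Sᶜ) t)) := by
  have pS : primeIdeal K G S ∈ (binomialEdgeIdeal K G).minimalPrimes :=
    primeIdeal_eq_labelIdeal (K := K) G S ▸ labelIdeal_mem_minimalPrimes hS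
  have pT : primeIdeal K G T ∈ (binomialEdgeIdeal K G).minimalPrimes :=
    primeIdeal_eq_labelIdeal (K := K) G T ▸ labelIdeal_mem_minimalPrimes hT
  have hh := hG _ pS _ pT
  have hadj : ∀ t ∈ T, t ∉ S →
      ((dualGraph (binomialEdgeIdeal K G)).Adj ⟨_, pS⟩ ⟨_, pT⟩ ↔
      (labelIdeal K S (compLabel G S) ⊔ labelIdeal K T (compLabel G T)).height =
        (labelIdeal K S (compLabel G S)).height + 1) := by
    intro t htT htS
    rw [dualGraph_adj_iff hG]
    simp only [primeIdeal_eq_labelIdeal, ne_eq, Subtype.mk.injEq, and_iff_right_iff_imp]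
    rintro - h
    exact htS (x_mem_labelIdeal_iff.1 (h ▸ x_mem_labelIdeal (K := K) htT))
  rw [primeIdeal_eq_labelIdeal, primeIdeal_eq_labelIdeal] at hh
  refine ⟨pS, pT, fun hcard => ?_, fun hcard hsub => ?_, fun t ht hnot => ?_⟩
  · obtain ⟨t, ht⟩ := Set.nonempty_of_ncard_ne_zero (by omega : (T \ S).ncard ≠ 0)
    rw [hadj t ht.1 ht.2]
    exact height_sup_ne_of_two_mem hh hcard
  · obtain ⟨t, ht⟩ := Set.ncard_eq_one.1 hcard
    obtain ⟨htT, htS⟩ : t ∈ T \ S := ht ▸ rfl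
    have hTU : T = insert t S := by
      rw [← Set.sdiff_union_of_subset hsub, ht, Set.singleton_union]
    obtain ⟨u, -, hu, -, htu, -⟩ := hT.exists_adj htT
    rw [hadj t htT htS]
    exact height_sup_eq htS (hTU ▸ hu) htu htT hTU.subset
      fun i j hi hj => compLabel_mono hsub (hTU ▸ hi) (hTU ▸ hj)
  · obtain ⟨htT, htS⟩ : (t : V) ∈ T \ S := ht ▸ rfl
    rw [hadj t htT htS]
    -- As `|S| ≤ |T|` and `|T \ S| = 1`, the nonempty set `S \ T` is a single vertex `s`, and `|S| =
    -- |T|`.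
    have h1 := Set.ncard_inter_add_ncard_sdiff_eq_ncard S T (Set.toFinite _)
    have h2 := Set.ncard_inter_add_ncard_sdiff_eq_ncard T S (Set.toFinite _)
    have h3 : (S \ T).ncard ≠ 0 := by
      rw [Ne, Set.ncard_eq_zero (Set.toFinite _), Set.sdiff_eq_empty]; exact hnot
    rw [Set.inter_comm, ht, Set.ncard_singleton] at h2
    obtain ⟨s, hs⟩ := Set.ncard_eq_one.1 (show (S \ T).ncard = 1 by omega)
    obtain ⟨hsS, hsT⟩ : s ∈ S \ T := hs ▸ rfl
    have hU : insert (t : V) S = insert s T := by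
      rw [← Set.singleton_union, ← ht, Set.sdiff_union_self, ← Set.singleton_union, ← hs,
        Set.sdiff_union_self, Set.union_comm]
    constructor
    · intro h hcut
      exact not_forall_compLabel_iff_of_isCutVertex hS hsS hsT hU hcut fun i j hi hj =>
        label_eq_iff_of_height_sup hh h hsS hsT htT htS hi hj hU
    · intro hcut
      -- The vertex `b` has neighbours in two components of `G - B`; at most one of them is `a`.
      have key : ∀ {A B : Set V} {a b : V}, IsCutSet G B → b ∈ B → insert b A = insert a B →
          ∃ u, u ∉ insert b A ∧ G.Adj b u := by
        intro A B a b hB hb hAB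
        obtain ⟨u, v, hu, hv, hbu, hbv, huv⟩ := hB.exists_adj hb
        by_cases hua : u = a
        · exact ⟨v, hAB ▸ fun h => h.elim (fun h => huv (by rw [hua, h])) hv, hbv⟩
        · exact ⟨u, hAB ▸ fun h => h.elim hua hu, hbu⟩
      obtain ⟨u, hu, htu⟩ := key hT htT hU
      obtain ⟨v, hv, hsv⟩ := key hS hsS hU.symm
      refine height_sup_eq htS hu htu htT (hU ▸ Set.subset_insert _ _) fun i j hi hj hij => ?_
      have hc := numComponents_eq_of_height_eq ((Set.ne_univ_iff_exists_notMem S).2 ⟨t, htS⟩)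
        ((Set.ne_univ_iff_exists_notMem T).2 ⟨s, hsT⟩) hh (show S.ncard = T.ncard by omega)
      -- Both component counts can be taken over the complement of `S ∪ T`.
      rw [numComponents_eq, numComponents_eq, ← compLabel_image_compl_insert htS hu htu,
        ← compLabel_image_compl_insert hsT hv hsv, ← hU] at hc
      -- Off `S ∪ T`, the partition by `G - (S ∪ T)` refines the one by `G - T`, and has no more
      -- classes because it is the one by `G - S`. So vertices joined in `G - T` are already joined
      -- in `G - (S ∪ T)`.
      refine compLabel_mono (Set.subset_insert (t : V) S) hi hj
        (eq_of_refines_of_ncard_image_le (A := (insert (t : V) S)ᶜ) (g := compLabel G T)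
          (fun a ha b hb hab => compLabel_mono (hU ▸ Set.subset_insert s T) ha hb hab) ?_ hi hj hij)
      rw [← hc]
      exact ncard_image_le_of_refines fun a ha b hb hab =>
        compLabel_insert_eq_of_not_isCutVertex hcut hu htu ha hb hab
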